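/- **Proposition (Compactness of $K_R/G_\infty$).** Fix $k\in\mathbb N$ and $R>0$, let $\mathbb R^k$ carry the Euclidean norm, and let $V=L^2([0,1];\mathbb R^k)$ and $$K_R=\{X\in V : \|X\|_{L^\infty}\le R\}.$$ Let $S_{[0,1]}$ be the group of measure-preserving bijections of $[0,1]$. The group $S_{[0,1]}\times \mathrm O(k)$ acts on $V$ by linear isometries, $((\varphi,h)\cdot X)(t)=h\bigl(X(\varphi^{-1}(t))\bigr)$. For $n\ge 1$ embed the symmetric group $S_n$ in $S_{[0,1]}$ by letting $\sigma\in S_n$ permute the $n$ consecutive intervals $[\frac{i-1}{n},\frac in)$ by translations and fix the point $1$. The union $S_\infty=\bigcup_{n\ge1}S_n$ is a subgroup of $S_{[0,1]}$ (for $n\mid N$, $S_n\subseteq S_N$ by $\sigma\mapsto\sigma\otimes I_{N/n}$), and $G_\infty=\bigcup_{n\ge 1}(S_n\times \mathrm O(k))=S_\infty\times \mathrm O(k)$. For a group $G$ acting on $V$ by linear isometries, $\overline{\mathrm d}(X,Y)=\inf_{g\in G}\|g\cdot X-Y\|_{L^2}$ induces a metric on the set of orbit closures $\overline{G\cdot X}$,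 $X\in V$. The orbit space $\overline V/G$ is the completion of this metric space, and for $K\subseteq V$ let $K/G\subseteq\overline V/G$ be the set of orbit closures of the points of $K$. Then $K_R/G_\infty$ is a compact subset of the orbit space $\overline V/G_\infty$. Likewise, when the symmetrized metric is taken over all measure-preserving bijections, that is, with $G=S_{[0,1]}\times \mathrm O(k)$ in place of $G_\infty$, $K_R/G$ is a compact subset of $\overline V/G$. -/

import Mathlib

open MeasureTheory
open scoped ENNReal

noncomputable section

namespace PointCloud

/-! ## Orbit closures and the orbit space of a group of linear isometries -/

section Orbits

variable {V : Type*} [NormedAddCommGroup V] [NormedSpace ℝ V]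

/-- The orbit of `x` under a group `G` of linear isometries of `V`. -/
def orbit (G : Subgroup (V ≃ₗᵢ[ℝ] V)) (x : V) : Set V :=
  {y | ∃ g ∈ G, g x = y}

/-- The symmetrized distance `inf_{g ∈ G} ‖g x - y‖`. -/
def symDist (G : Subgroup (V ≃ₗᵢ[ℝ] V)) (x y : V) : ℝ :=
  ⨅ g : G, ‖(g : V ≃ₗᵢ[ℝ] V) x - y‖

theorem symDist_le (G : Subgroup (V ≃ₗᵢ[ℝ] V)) (x y : V) {g : V ≃ₗᵢ[ℝ] V} (hg : g ∈ G) :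
    symDist G x y ≤ ‖g x - y‖ :=
  ciInf_le (f := fun g : G => ‖(g : V ≃ₗᵢ[ℝ] V) x - y‖)
    ⟨0, by rintro _ ⟨g, rfl⟩; exact norm_nonneg _⟩ ⟨g, hg⟩

theorem symDist_nonneg (G : Subgroup (V ≃ₗᵢ[ℝ] V)) (x y : V) : 0 ≤ symDist G x y :=
  Real.iInf_nonneg fun _ => norm_nonneg _

theorem exists_lt_of_symDist_lt (G : Subgroup (V ≃ₗᵢ[ℝ] V)) {x y : V} {r : ℝ}
    (h : symDist G x y < r) : ∃ g ∈ G, ‖g x - y‖ < r := by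
  obtain ⟨g, hg⟩ := exists_lt_of_ciInf_lt h
  exact ⟨g, g.2, hg⟩

theorem symDist_self (G : Subgroup (V ≃ₗᵢ[ℝ] V)) (x : V) : symDist G x x = 0 :=
  le_antisymm (by simpa using symDist_le G x x G.one_mem) (symDist_nonneg G x x)

theorem symDist_comm_le (G : Subgroup (V ≃ₗᵢ[ℝ] V)) (x y : V) :
    symDist G x y ≤ symDist G y x := by
  refine le_ciInf fun g => (symDist_le G x y (G.inv_mem g.2)).trans (le_of_eq ?_)
  rw [← (g : V ≃ₗᵢ[ℝ] V).norm_map, map_sub, norm_sub_rev]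
  exact congrArg (fun z => ‖(g : V ≃ₗᵢ[ℝ] V) y - z‖) (LinearIsometryEquiv.apply_symm_apply _ x)

theorem symDist_comm (G : Subgroup (V ≃ₗᵢ[ℝ] V)) (x y : V) : symDist G x y = symDist G y x :=
  le_antisymm (symDist_comm_le G x y) (symDist_comm_le G y x)

theorem symDist_triangle (G : Subgroup (V ≃ₗᵢ[ℝ] V)) (x y z : V) :
    symDist G x z ≤ symDist G x y + symDist G y z := by
  refine le_of_forall_pos_le_add fun ε hε => ?_
  obtain ⟨g, hg, hgx⟩ := exists_lt_of_symDist_lt G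
    (lt_add_of_pos_right (symDist G x y) (half_pos hε))
  obtain ⟨h, hh, hhy⟩ := exists_lt_of_symDist_lt G
    (lt_add_of_pos_right (symDist G y z) (half_pos hε))
  have h1 : symDist G x z ≤ ‖h (g x) - z‖ := symDist_le G x z (G.mul_mem hh hg)
  have h2 : ‖h (g x) - z‖ ≤ ‖h (g x) - h y‖ + ‖h y - z‖ := norm_sub_le_norm_sub_add_norm_sub _ _ _
  have h3 : ‖h (g x) - h y‖ = ‖g x - y‖ := by rw [← map_sub, h.norm_map]
  linarith

theorem mem_closure_orbit_iff (G : Subgroup (V ≃ₗᵢ[ℝ] V)) (x y : V) :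
    y ∈ closure (orbit G x) ↔ symDist G x y = 0 := by
  rw [Metric.mem_closure_iff]
  constructor
  · intro h
    refine le_antisymm (le_of_forall_pos_le_add fun ε hε => ?_) (symDist_nonneg G x y)
    obtain ⟨_, ⟨g, hg, rfl⟩, hd⟩ := h ε hε
    rw [dist_comm, dist_eq_norm] at hd
    linarith [symDist_le G x y hg]
  · intro h ε hε
    obtain ⟨g, hg, hd⟩ := exists_lt_of_symDist_lt G (h.trans_lt hε)
    exact ⟨g x, ⟨g, hg, rfl⟩, by rwa [dist_comm, dist_eq_norm]⟩

/-- Two orbit closures coincide exactly when the symmetrized distance vanishes. -/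
theorem closure_orbit_eq_iff (G : Subgroup (V ≃ₗᵢ[ℝ] V)) (x y : V) :
    closure (orbit G x) = closure (orbit G y) ↔ symDist G x y = 0 := by
  constructor
  · intro h
    rw [← mem_closure_orbit_iff, h, mem_closure_orbit_iff, symDist_self]
  · intro h
    ext z
    rw [mem_closure_orbit_iff, mem_closure_orbit_iff]
    have h1 := symDist_triangle G x y z
    have h2 := symDist_triangle G y x z
    rw [symDist_comm G y x] at h2
    have h3 := symDist_nonneg G x z
    have h4 := symDist_nonneg G y z
    constructor <;> intro _ <;> linarith

/-- The set of all orbit closures. -/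
def OrbitClosures (G : Subgroup (V ≃ₗᵢ[ℝ] V)) : Type _ :=
  {S : Set V // ∃ x, closure (orbit G x) = S}

/-- The orbit closure of `x`. -/
def orbitClosure (G : Subgroup (V ≃ₗᵢ[ℝ] V)) (x : V) : OrbitClosures G :=
  ⟨closure (orbit G x), x, rfl⟩

/-- A point whose orbit closure is `S`. -/
def OrbitClosures.rep {G : Subgroup (V ≃ₗᵢ[ℝ] V)} (S : OrbitClosures G) : V := S.2.choose

theorem closure_orbit_rep {G : Subgroup (V ≃ₗᵢ[ℝ] V)} (S : OrbitClosures G) :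
    closure (orbit G S.rep) = S.1 := S.2.choose_spec

/-- The metric on orbit closures that the symmetrized distance induces; by `dist_orbitClosure` it
does not depend on the representatives. -/
instance instMetricSpaceOrbitClosures (G : Subgroup (V ≃ₗᵢ[ℝ] V)) :
    MetricSpace (OrbitClosures G) where
  dist S T := symDist G S.rep T.rep
  dist_self S := symDist_self G _
  dist_comm S T := symDist_comm G _ _
  dist_triangle S T U := symDist_triangle G _ _ _
  eq_of_dist_eq_zero {S T} h := Subtype.ext <| by
    rw [← closure_orbit_rep S, ← closure_orbit_rep T]
    exact (closure_orbit_eq_iff G _ _).2 h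

theorem dist_orbitClosure (G : Subgroup (V ≃ₗᵢ[ℝ] V)) (x y : V) :
    dist (orbitClosure G x) (orbitClosure G y) = symDist G x y := by
  change symDist G (orbitClosure G x).rep (orbitClosure G y).rep = symDist G x y
  have hx := (closure_orbit_eq_iff G _ _).1 (closure_orbit_rep (orbitClosure G x))
  have hy := (closure_orbit_eq_iff G _ _).1 (closure_orbit_rep (orbitClosure G y))
  have hx' := hx
  have hy' := hy
  rw [symDist_comm] at hx' hy'
  have h1 := symDist_triangle G (orbitClosure G x).rep x (orbitClosure G y).rep
  have h2 := symDist_triangle G x y (orbitClosure G y).rep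
  have h3 := symDist_triangle G x (orbitClosure G x).rep y
  have h4 := symDist_triangle G (orbitClosure G x).rep (orbitClosure G y).rep y
  linarith

/-- The orbit space: the completion of the metric space of orbit closures. -/
abbrev OrbitSpace (G : Subgroup (V ≃ₗᵢ[ℝ] V)) : Type _ :=
  UniformSpace.Completion (OrbitClosures G)

/-- `K / G`, the set of orbit closures of the points of `K`, as a subset of the orbit space. -/
def orbitClosuresOf (G : Subgroup (V ≃ₗᵢ[ℝ] V)) (K : Set V) : Set (OrbitSpace G) :=
  (fun x : V => ((orbitClosure G x : OrbitClosures G) : OrbitSpace G)) '' K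

end Orbits

/-! ## Measure-preserving bijections of `[0,1]` and permutations of intervals -/

/-- The group of measure-preserving bijections of `[0,1]` (Lebesgue measure). -/
def measurePreservingPerms : Subgroup (Equiv.Perm unitInterval) where
  carrier := {φ | MeasurePreserving φ volume volume ∧
    MeasurePreserving φ.symm volume volume}
  one_mem' := ⟨MeasurePreserving.id _, MeasurePreserving.id _⟩
  mul_mem' := fun ha hb => ⟨ha.1.comp hb.1, hb.2.comp ha.2⟩
  inv_mem' := fun ha => ⟨ha.2, ha.1⟩

/-- The permutation of `ℕ` that acts as `σ` on `{0, …, n - 1}` and fixes all other numbers. -/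
def extendPerm (n : ℕ) (σ : Equiv.Perm (Fin n)) : Equiv.Perm ℕ :=
  σ.extendDomain Fin.equivSubtype

theorem extendPerm_of_lt {n : ℕ} (σ : Equiv.Perm (Fin n)) {i : ℕ} (h : i < n) :
    extendPerm n σ i = σ ⟨i, h⟩ := by
  exact Equiv.Perm.extendDomain_apply_subtype σ Fin.equivSubtype h

theorem extendPerm_of_le {n : ℕ} (σ : Equiv.Perm (Fin n)) {i : ℕ} (h : n ≤ i) :
    extendPerm n σ i = i :=
  Equiv.Perm.extendDomain_apply_not_subtype _ _ (by omega)

theorem extendPerm_lt {n : ℕ} (σ : Equiv.Perm (Fin n)) {i : ℕ} (h : i < n) :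
    extendPerm n σ i < n := by
  rw [extendPerm_of_lt σ h]; exact (σ _).2

theorem extendPerm_mul {n : ℕ} (σ τ : Equiv.Perm (Fin n)) (i : ℕ) :
    extendPerm n (σ * τ) i = extendPerm n σ (extendPerm n τ i) := by
  rw [extendPerm, ← Equiv.Perm.extendDomain_mul]; rfl

/-- `t ↦ t + (σ(i) - i) / n` for `t ∈ [i / n, (i + 1) / n)`, `i = 0, …, n - 1`, and `1 ↦ 1`: the
consecutive intervals of length `1 / n` are permuted by translations. -/
def intervalShift (n : ℕ) (σ : Equiv.Perm (Fin n)) (t : ℝ) : ℝ :=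
  t + ((extendPerm n σ ⌊n * t⌋₊ : ℝ) - (⌊n * t⌋₊ : ℝ)) / n

theorem floor_intervalShift {n : ℕ} (σ : Equiv.Perm (Fin n)) {t : ℝ} (ht : 0 ≤ t) :
    ⌊n * intervalShift n σ t⌋₊ = extendPerm n σ ⌊n * t⌋₊ := by
  rcases Nat.eq_zero_or_pos n with rfl | hn
  · simp [intervalShift, extendPerm_of_le]
  have hn' : (0 : ℝ) < n := by exact_mod_cast hn
  have h1 := Nat.floor_le (mul_nonneg hn'.le ht)
  have h2 := Nat.lt_floor_add_one ((n : ℝ) * t)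
  have h3 : (n : ℝ) * intervalShift n σ t
      = n * t + ((extendPerm n σ ⌊n * t⌋₊ : ℝ) - (⌊n * t⌋₊ : ℝ)) := by
    rw [intervalShift]; field_simp
  have h4 : (0 : ℝ) ≤ extendPerm n σ ⌊n * t⌋₊ := Nat.cast_nonneg _
  rw [h3, Nat.floor_eq_iff (by linarith)]
  constructor <;> linarith

theorem intervalShift_mem {n : ℕ} (σ : Equiv.Perm (Fin n)) {t : ℝ} (ht : t ∈ unitInterval) :
    intervalShift n σ t ∈ unitInterval := by
  rcases Nat.eq_zero_or_pos n with rfl | hn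
  · simpa [intervalShift] using ht
  have hn' : (0 : ℝ) < n := by exact_mod_cast hn
  rcases lt_or_ge ⌊n * t⌋₊ n with h | h
  · have h1 := Nat.floor_le (mul_nonneg hn'.le ht.1)
    have h2 := Nat.lt_floor_add_one ((n : ℝ) * t)
    have h3 : (n : ℝ) * intervalShift n σ t
        = n * t + ((extendPerm n σ ⌊n * t⌋₊ : ℝ) - (⌊n * t⌋₊ : ℝ)) := by
      rw [intervalShift]; field_simp
    have h4 : (0 : ℝ) ≤ extendPerm n σ ⌊n * t⌋₊ := Nat.cast_nonneg _
    have h5 : (extendPerm n σ ⌊n * t⌋₊ : ℝ) + 1 ≤ n := by exact_mod_cast extendPerm_lt σ h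
    constructor
    · by_contra! h6
      have := mul_neg_of_pos_of_neg hn' h6
      linarith
    · by_contra! h6
      have := mul_lt_mul_of_pos_left h6 hn'
      linarith
  · rw [intervalShift, extendPerm_of_le σ h]
    simpa using ht

theorem intervalShift_mul {n : ℕ} (σ τ : Equiv.Perm (Fin n)) {t : ℝ} (ht : 0 ≤ t) :
    intervalShift n (σ * τ) t = intervalShift n σ (intervalShift n τ t) := by
  conv_rhs => rw [intervalShift, floor_intervalShift τ ht, intervalShift]
  rw [intervalShift, extendPerm_mul]
  ring

theorem intervalShift_one (n : ℕ) (t : ℝ) : intervalShift n 1 t = t := by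
  have : extendPerm n 1 = 1 := Equiv.Perm.extendDomain_one _
  simp [intervalShift, this]

theorem measurable_intervalShift (n : ℕ) (σ : Equiv.Perm (Fin n)) :
    Measurable (intervalShift n σ) := by
  have hfl : Measurable fun t : ℝ => ⌊n * t⌋₊ := Nat.measurable_floor.comp (measurable_const_mul _)
  have h1 : Measurable fun t : ℝ => ((extendPerm n σ ⌊n * t⌋₊ : ℕ) : ℝ) :=
    (measurable_from_top (f := fun i : ℕ => ((extendPerm n σ i : ℕ) : ℝ))).comp hfl
  have h2 : Measurable fun t : ℝ => ((⌊n * t⌋₊ : ℕ) : ℝ) :=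
    (measurable_from_top (f := fun i : ℕ => (i : ℝ))).comp hfl
  exact measurable_id.add ((h1.sub h2).div_const _)

/-- `intervalShift` as a self-map of `[0,1]`. -/
def intervalMap (n : ℕ) (σ : Equiv.Perm (Fin n)) (t : unitInterval) : unitInterval :=
  ⟨intervalShift n σ t, intervalShift_mem σ t.2⟩

theorem intervalMap_mul {n : ℕ} (σ τ : Equiv.Perm (Fin n)) (t : unitInterval) :
    intervalMap n (σ * τ) t = intervalMap n σ (intervalMap n τ t) :=
  Subtype.ext (intervalShift_mul σ τ t.2.1)

theorem intervalMap_one (n : ℕ) (t : unitInterval) : intervalMap n 1 t = t :=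
  Subtype.ext (intervalShift_one n t)

theorem measurable_intervalMap (n : ℕ) (σ : Equiv.Perm (Fin n)) : Measurable (intervalMap n σ) :=
  ((measurable_intervalShift n σ).comp measurable_subtype_coe).subtype_mk

theorem volume_eq_tsum_cells (n : ℕ) {A : Set unitInterval} (hA : MeasurableSet A) :
    volume A = ∑' i : ℕ, volume (A ∩ {t : unitInterval | ⌊(n : ℝ) * t⌋₊ = i}) := by
  have hfl : Measurable fun t : unitInterval => ⌊(n : ℝ) * t⌋₊ :=
    Nat.measurable_floor.comp ((measurable_const_mul _).comp measurable_subtype_coe)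
  have hm : ∀ i : ℕ, MeasurableSet {t : unitInterval | ⌊(n : ℝ) * t⌋₊ = i} := fun i =>
    hfl (measurableSet_singleton i)
  rw [← measure_iUnion]
  · congr 1
    ext t
    simp
  · intro i j hij
    refine Set.disjoint_left.2 fun t hi hj => hij ?_
    exact hi.2.symm.trans hj.2
  · exact fun i => hA.inter (hm i)

theorem measurePreserving_intervalMap (n : ℕ) (σ : Equiv.Perm (Fin n)) :
    MeasurePreserving (intervalMap n σ) := by
  refine ⟨measurable_intervalMap n σ, Measure.ext fun A hA => ?_⟩
  rw [Measure.map_apply (measurable_intervalMap n σ) hA,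
    volume_eq_tsum_cells n (measurable_intervalMap n σ hA), volume_eq_tsum_cells n hA,
    ← (extendPerm n σ).tsum_eq fun i =>
      volume (A ∩ {t : unitInterval | ⌊(n : ℝ) * t⌋₊ = i})]
  refine tsum_congr fun i => ?_
  have hI : MeasurableSet (unitInterval : Set ℝ) := measurableSet_Icc
  have hval : ∀ s : Set unitInterval, (volume : Measure unitInterval) s = volume (Subtype.val '' s) := fun s => by
    rw [Measure.Subtype.volume_def, comap_subtype_coe_apply hI]
  rw [hval, hval, ← measure_preimage_add_right volume (((extendPerm n σ i : ℝ) - (i : ℝ)) / n)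
    (Subtype.val '' (A ∩ {t : unitInterval | ⌊(n : ℝ) * t⌋₊ = extendPerm n σ i}))]
  congr 1
  have hinj : ∀ t : unitInterval, intervalMap n σ (intervalMap n σ⁻¹ t) = t := fun t => by
    rw [← intervalMap_mul, mul_inv_cancel, intervalMap_one]
  have hinv : ∀ j, extendPerm n σ⁻¹ (extendPerm n σ j) = j := fun j => by
    rw [← extendPerm_mul, inv_mul_cancel]
    simp [extendPerm]
  ext x
  constructor
  · rintro ⟨t, ⟨htA, hti⟩, rfl⟩
    have hti' : ⌊(n : ℝ) * t⌋₊ = i := hti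
    refine ⟨intervalMap n σ t, ⟨htA, ?_⟩, ?_⟩
    · change ⌊(n : ℝ) * intervalShift n σ t⌋₊ = _
      rw [floor_intervalShift σ t.2.1, hti']
    · change intervalShift n σ t = _
      rw [intervalShift, hti']
  · rintro ⟨s, ⟨hsA, hsi⟩, hs⟩
    have hsi' : ⌊(n : ℝ) * s⌋₊ = extendPerm n σ i := hsi
    refine ⟨intervalMap n σ⁻¹ s, ⟨?_, ?_⟩, ?_⟩
    · change intervalMap n σ (intervalMap n σ⁻¹ s) ∈ A
      rwa [hinj]
    · change ⌊(n : ℝ) * intervalShift n σ⁻¹ s⌋₊ = _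
      rw [floor_intervalShift _ s.2.1, hsi', hinv]
    · change intervalShift n σ⁻¹ s = x
      have hs' : (s : ℝ) = x + ((extendPerm n σ i : ℝ) - (i : ℝ)) / n := hs
      rw [intervalShift, hsi', hinv, hs']
      ring

/-- The embedding of `S_n` into the group of measure-preserving bijections of `[0,1]`: `σ` permutes
the `n` consecutive intervals of length `1 / n`. -/
def intervalPerm (n : ℕ) : Equiv.Perm (Fin n) →* measurePreservingPerms where
  toFun σ := ⟨{ toFun := intervalMap n σ
                invFun := intervalMap n σ⁻¹
                left_inv := fun t => by rw [← intervalMap_mul, inv_mul_cancel, intervalMap_one]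
                right_inv := fun t => by rw [← intervalMap_mul, mul_inv_cancel, intervalMap_one] },
    measurePreserving_intervalMap n σ, measurePreserving_intervalMap n σ⁻¹⟩
  map_one' := Subtype.ext (Equiv.ext (intervalMap_one n))
  map_mul' σ τ := Subtype.ext (Equiv.ext (intervalMap_mul σ τ))

theorem coe_intervalPerm_apply (n : ℕ) (σ : Equiv.Perm (Fin n)) (t : unitInterval) :
    (((intervalPerm n σ : measurePreservingPerms) : Equiv.Perm unitInterval) t : ℝ) = intervalShift n σ t :=
  rfl

/-- The embedding `σ ↦ σ ⊗ I_m` of `S_n` into `S_{n m}`. -/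
def tensorPerm (n m : ℕ) (σ : Equiv.Perm (Fin n)) : Equiv.Perm (Fin (n * m)) :=
  finProdFinEquiv.permCongr (Equiv.prodCongr σ (Equiv.refl (Fin m)))

/-- The embeddings of `S_n` and `S_{n m}` are compatible. -/
theorem intervalPerm_tensorPerm (n m : ℕ) (hm : 0 < m) (σ : Equiv.Perm (Fin n)) :
    intervalPerm (n * m) (tensorPerm n m σ) = intervalPerm n σ := by
  refine Subtype.ext (Equiv.ext fun t => Subtype.ext ?_)
  rw [coe_intervalPerm_apply, coe_intervalPerm_apply, intervalShift, intervalShift]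
  have hm' : (m : ℝ) ≠ 0 := by exact_mod_cast hm.ne'
  set j := ⌊((n * m : ℕ) : ℝ) * t⌋₊ with hj
  have hi : ⌊(n : ℝ) * t⌋₊ = j / m := by
    rw [hj, ← Nat.floor_div_natCast]
    congr 1
    push_cast
    field_simp
  rw [hi]
  rcases lt_or_ge j (n * m) with h | h
  · have h' : j / m < n := (Nat.div_lt_iff_lt_mul hm).2 h
    rw [extendPerm_of_lt _ h, extendPerm_of_lt _ h']
    have hv : ((tensorPerm n m σ ⟨j, h⟩ : Fin (n * m)) : ℕ) = j % m + m * (σ ⟨j / m, h'⟩ : ℕ) := rfl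
    have hd : (j : ℝ) = (j % m : ℕ) + m * (j / m : ℕ) := by exact_mod_cast (Nat.mod_add_div j m).symm
    rw [hv]
    have hn' : (n : ℝ) ≠ 0 := by
      have : 0 < n := by omega
      exact_mod_cast this.ne'
    push_cast at hd ⊢
    field_simp
    linear_combination -hd
  · have h' : n ≤ j / m := (Nat.le_div_iff_mul_le hm).2 h
    rw [extendPerm_of_le _ h, extendPerm_of_le _ h']
    simp

/-- The union of the groups `S_n`, `n ≥ 1`, along the embeddings `σ ↦ σ ⊗ I_m`, realized as
permutations of intervals. -/
def intervalPerms : Subgroup measurePreservingPerms where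
  carrier := {φ | ∃ n : ℕ, 0 < n ∧ ∃ σ : Equiv.Perm (Fin n), intervalPerm n σ = φ}
  one_mem' := ⟨1, one_pos, 1, map_one _⟩
  mul_mem' := by
    rintro _ _ ⟨n, hn, σ, rfl⟩ ⟨m, hm, τ, rfl⟩
    have key : ∀ N, N = m * n → ∃ τ' : Equiv.Perm (Fin N), intervalPerm N τ' = intervalPerm m τ := by
      rintro _ rfl
      exact ⟨tensorPerm m n τ, intervalPerm_tensorPerm m n hn τ⟩
    obtain ⟨τ', hτ'⟩ := key (n * m) (mul_comm _ _)
    exact ⟨n * m, Nat.mul_pos hn hm, tensorPerm n m σ * τ', by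
      rw [map_mul, intervalPerm_tensorPerm n m hm, hτ']⟩
  inv_mem' := by
    rintro _ ⟨n, hn, σ, rfl⟩
    exact ⟨n, hn, σ⁻¹, map_inv _ _⟩

/-! ## The limit space of point clouds and its symmetries -/

/-- The limit space `L²([0,1]; ℝᵏ)`. -/
abbrev LimitSpace (k : ℕ) : Type :=
  Lp (EuclideanSpace ℝ (Fin k)) 2 (volume : Measure unitInterval)

/-- The orthogonal group `O(k)`, as the group of linear isometries of Euclidean space `ℝᵏ`. -/
abbrev OrthGroup (k : ℕ) : Type :=
  EuclideanSpace ℝ (Fin k) ≃ₗᵢ[ℝ] EuclideanSpace ℝ (Fin k)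

/-- The function `t ↦ h (X (φ⁻¹ t))` as an element of `L²`. -/
def actFun (k : ℕ) (g : measurePreservingPerms × OrthGroup k) (X : LimitSpace k) : LimitSpace k :=
  (g.2 : EuclideanSpace ℝ (Fin k) →L[ℝ] EuclideanSpace ℝ (Fin k)).compLp
    (Lp.compMeasurePreserving (g.1 : Equiv.Perm unitInterval).symm g.1.2.2 X)

theorem coeFn_actFun (k : ℕ) (g : measurePreservingPerms × OrthGroup k) (X : LimitSpace k) :
    actFun k g X =ᵐ[volume] fun t => g.2 (X ((g.1 : Equiv.Perm unitInterval).symm t)) := by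
  filter_upwards [ContinuousLinearMap.coeFn_compLp
    (g.2 : EuclideanSpace ℝ (Fin k) →L[ℝ] EuclideanSpace ℝ (Fin k))
    (Lp.compMeasurePreserving (g.1 : Equiv.Perm unitInterval).symm g.1.2.2 X),
    Lp.coeFn_compMeasurePreserving X g.1.2.2] with t h1 h2
  exact h1.trans (congrArg g.2 h2)

theorem actFun_one (k : ℕ) (X : LimitSpace k) : actFun k 1 X = X :=
  Lp.ext (coeFn_actFun k 1 X)

theorem actFun_mul (k : ℕ) (g h : measurePreservingPerms × OrthGroup k) (X : LimitSpace k) :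
    actFun k (g * h) X = actFun k g (actFun k h X) := by
  refine Lp.ext ((coeFn_actFun k _ X).trans ?_)
  filter_upwards [coeFn_actFun k g (actFun k h X),
    g.1.2.2.quasiMeasurePreserving.ae (coeFn_actFun k h X)] with t h1 h2
  rw [h1, h2]
  rfl

theorem norm_actFun (k : ℕ) (g : measurePreservingPerms × OrthGroup k) (X : LimitSpace k) :
    ‖actFun k g X‖ = ‖X‖ := by
  rw [← Lp.norm_compMeasurePreserving X g.1.2.2, Lp.norm_def, Lp.norm_def]
  congr 1
  refine eLpNorm_congr_norm_ae ?_
  filter_upwards [coeFn_actFun k g X, Lp.coeFn_compMeasurePreserving X g.1.2.2] with t h1 h2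
  rw [h1, h2, LinearIsometryEquiv.norm_map]
  rfl

/-- The action `((φ, h) · X)(t) = h (X (φ⁻¹ t))` of pairs of a measure-preserving bijection `φ` of
`[0,1]` and `h ∈ O(k)` on `L²([0,1]; ℝᵏ)` by linear isometries. -/
def act (k : ℕ) : measurePreservingPerms × OrthGroup k →* (LimitSpace k ≃ₗᵢ[ℝ] LimitSpace k) where
  toFun g :=
    { toFun := actFun k g
      invFun := actFun k g⁻¹
      left_inv := fun X => by rw [← actFun_mul, inv_mul_cancel, actFun_one]
      right_inv := fun X => by rw [← actFun_mul, mul_inv_cancel, actFun_one]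
      map_add' := fun X Y => (congrArg _ (map_add (Lp.compMeasurePreserving _ g.1.2.2) X Y)).trans
        (map_add (ContinuousLinearMap.compLpL 2 volume
          (g.2 : EuclideanSpace ℝ (Fin k) →L[ℝ] EuclideanSpace ℝ (Fin k))) _ _)
      map_smul' := fun c X =>
        (congrArg _ (map_smul (Lp.compMeasurePreservingₗ ℝ _ g.1.2.2) c X)).trans
          (map_smul (ContinuousLinearMap.compLpL 2 volume
            (g.2 : EuclideanSpace ℝ (Fin k) →L[ℝ] EuclideanSpace ℝ (Fin k))) c _)
      norm_map' := norm_actFun k g }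
  map_one' := LinearIsometryEquiv.ext (actFun_one k)
  map_mul' g h := LinearIsometryEquiv.ext (actFun_mul k g h)

/-- The limiting group `G_∞`, the union of the groups `S_n × O(k)`, acting on `L²([0,1]; ℝᵏ)`. -/
def limitGroup (k : ℕ) : Subgroup (LimitSpace k ≃ₗᵢ[ℝ] LimitSpace k) :=
  (intervalPerms.prod ⊤).map (act k)

/-- The group `S_{[0,1]} × O(k)`, acting on `L²([0,1]; ℝᵏ)`. -/
def fullGroup (k : ℕ) : Subgroup (LimitSpace k ≃ₗᵢ[ℝ] LimitSpace k) :=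
  (act k).range

/-- `K_R`, the set of all `X ∈ L²([0,1]; ℝᵏ)` with `‖X‖_{L^∞} ≤ R`. -/
def boundedClouds (k : ℕ) (R : ℝ) : Set (LimitSpace k) :=
  {X | eLpNorm X ∞ volume ≤ ENNReal.ofReal R}

end PointCloud

end

/-!
A subset of a metric space is compact when it is complete and totally bounded, and both properties
of `K_R / G` are checked among the orbit closures, before completing.

*Completeness* (`isComplete_image_orbitClosure`) is formal: `K_R` is closed in the complete space
`L²` and invariant under `G`, so a rapidly Cauchy sequence of orbit closures lifts to a Cauchy
sequence of points of `K_R`, whose limit represents the limit orbit closure.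

*Total boundedness* (`exists_totallyBounded_symDist_lt`) rests on sorting. Fix a finite `ε`-net `F`
of the ball of radius `R` in `ℝᵏ`. Every cloud in `K_R` is `5ε`-close to a step cloud on some number
`n` of equal intervals with values in `F` (`exists_norm_sub_stepCloud_lt`). Here `n` depends on the
cloud, but a permutation in `S_n` sorts the values along the enumeration of `F`, and a sorted cloud
is determined by its breakpoints (`exists_limitGroup_apply_stepCloud`). It depends continuously on
them (`continuous_sortedCloud`), so that the sorted clouds lie in a compact subset of `L²` that does
not depend on `n`. Sorting only uses elements of `G_∞`, and passing to the larger group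
`S_{[0,1]} × O(k)` decreases the symmetrized distance, so the same compact set serves for both
groups.
-/

noncomputable section

namespace PointCloud

/-! ### Compactness criterion for sets of orbit closures -/

section Orbits

open Filter Topology

variable {V : Type*} [NormedAddCommGroup V] [NormedSpace ℝ V]

theorem orbitClosure_apply (G : Subgroup (V ≃ₗᵢ[ℝ] V)) {g : V ≃ₗᵢ[ℝ] V} (hg : g ∈ G) (x : V) :
    orbitClosure G (g x) = orbitClosure G x := by
  refine Subtype.ext ((closure_orbit_eq_iff G _ _).2 ?_)
  rw [symDist_comm]
  exact le_antisymm (by simpa using symDist_le G x (g x) hg) (symDist_nonneg G _ _)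

theorem dist_orbitClosure_le (G : Subgroup (V ≃ₗᵢ[ℝ] V)) (x y : V) :
    dist (orbitClosure G x) (orbitClosure G y) ≤ dist x y := by
  rw [dist_orbitClosure, dist_eq_norm]
  simpa using symDist_le G x y G.one_mem

theorem continuous_orbitClosure (G : Subgroup (V ≃ₗᵢ[ℝ] V)) : Continuous (orbitClosure G) :=
  (LipschitzWith.of_dist_le_mul (K := 1) fun x y => by
    simpa using dist_orbitClosure_le G x y).continuous

theorem symDist_anti {G H : Subgroup (V ≃ₗᵢ[ℝ] V)} (h : G ≤ H) (x y : V) :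
    symDist H x y ≤ symDist G x y :=
  le_ciInf fun g => symDist_le H x y (h g.2)

/-- The orbit closures of the points of a closed invariant set form a complete set: a rapidly
Cauchy sequence of orbit closures is represented by a Cauchy sequence of points, each
representative being chosen close to the preceding one. -/
theorem isComplete_image_orbitClosure [CompleteSpace V] (G : Subgroup (V ≃ₗᵢ[ℝ] V)) {K : Set V}
    (hK : IsClosed K) (hinv : ∀ g ∈ G, ∀ x ∈ K, g x ∈ K) :
    IsComplete (orbitClosure G '' K) := by
  rw [← completeSpace_coe_iff_isComplete]
  refine Metric.complete_of_convergent_controlled_sequences (fun n => (1 / 2 : ℝ) ^ n)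
    (fun n => by positivity) fun u hu => ?_
  have hstep : ∀ n (y : {y : V // y ∈ K ∧ orbitClosure G y = (u n).1}),
      ∃ z : {z : V // z ∈ K ∧ orbitClosure G z = (u (n + 1)).1},
        dist y.1 z.1 ≤ 1 * (1 / 2 : ℝ) ^ n := by
    rintro n ⟨y, hyK, hy⟩
    obtain ⟨x, hxK, hx⟩ := (u (n + 1)).2
    have hd : symDist G x y < (1 / 2 : ℝ) ^ n := by
      rw [← dist_orbitClosure, hx, hy]
      exact hu n (n + 1) n (Nat.le_succ n) le_rfl
    obtain ⟨g, hg, hgx⟩ := exists_lt_of_symDist_lt G hd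
    refine ⟨⟨g x, hinv g hg x hxK, (orbitClosure_apply G hg x).trans hx⟩, ?_⟩
    rw [one_mul, dist_comm, dist_eq_norm]
    exact hgx.le
  choose next hnext using hstep
  obtain ⟨x₀, hx₀K, hx₀⟩ := (u 0).2
  let y : ∀ n, {y : V // y ∈ K ∧ orbitClosure G y = (u n).1} :=
    fun n => Nat.rec ⟨x₀, hx₀K, hx₀⟩ next n
  have hy : CauchySeq fun n => (y n).1 :=
    cauchySeq_of_le_geometric (1 / 2) 1 (by norm_num) fun n => hnext n (y n)
  obtain ⟨z, hz⟩ := cauchySeq_tendsto_of_complete hy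
  have hzK : z ∈ K := hK.mem_of_tendsto hz (Eventually.of_forall fun n => (y n).2.1)
  refine ⟨⟨orbitClosure G z, z, hzK, rfl⟩, tendsto_subtype_rng.2 ?_⟩
  exact (((continuous_orbitClosure G).tendsto z).comp hz).congr fun n => (y n).2.2

/-- It suffices to approximate the points of `K` modulo `G` by totally bounded sets, which may
depend on the required precision. -/
theorem totallyBounded_image_orbitClosure (G : Subgroup (V ≃ₗᵢ[ℝ] V)) {K : Set V}
    (h : ∀ ε > 0, ∃ B : Set V, TotallyBounded B ∧ ∀ x ∈ K, ∃ y ∈ B, symDist G x y < ε) :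
    TotallyBounded (orbitClosure G '' K) := by
  refine Metric.totallyBounded_iff.2 fun ε hε => ?_
  obtain ⟨B, hB, hKB⟩ := h (ε / 2) (half_pos hε)
  obtain ⟨t, ht, hBt⟩ := Metric.totallyBounded_iff.1 hB (ε / 2) (half_pos hε)
  refine ⟨orbitClosure G '' t, ht.image _, ?_⟩
  rintro _ ⟨x, hx, rfl⟩
  obtain ⟨y, hy, hxy⟩ := hKB x hx
  obtain ⟨z, hz, hyz⟩ := Set.mem_iUnion₂.1 (hBt hy)
  refine Set.mem_iUnion₂.2 ⟨_, Set.mem_image_of_mem _ hz, ?_⟩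
  rw [← dist_orbitClosure] at hxy
  have h1 := dist_orbitClosure_le G y z
  have h2 := dist_triangle (orbitClosure G x) (orbitClosure G y) (orbitClosure G z)
  rw [Metric.mem_ball] at hyz ⊢
  linarith

theorem isCompact_orbitClosuresOf [CompleteSpace V] (G : Subgroup (V ≃ₗᵢ[ℝ] V)) {K : Set V}
    (hK : IsClosed K) (hinv : ∀ g ∈ G, ∀ x ∈ K, g x ∈ K)
    (h : ∀ ε > 0, ∃ B : Set V, TotallyBounded B ∧ ∀ x ∈ K, ∃ y ∈ B, symDist G x y < ε) :
    IsCompact (orbitClosuresOf G K) := by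
  have hc : IsCompact (orbitClosure G '' K) := isCompact_iff_totallyBounded_isComplete.2
    ⟨totallyBounded_image_orbitClosure G h, isComplete_image_orbitClosure G hK hinv⟩
  have := hc.image (UniformSpace.Completion.continuous_coe (OrbitClosures G))
  rwa [Set.image_image] at this

end Orbits

/-! ### Bounded clouds -/

section Clouds

open Filter Topology

variable {k : ℕ}

theorem act_apply (g : measurePreservingPerms × OrthGroup k) (X : LimitSpace k) :
    act k g X = actFun k g X := rfl

theorem limitGroup_le_fullGroup (k : ℕ) : limitGroup k ≤ fullGroup k :=
  fun _ ⟨g, _, hg⟩ => ⟨g, hg⟩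

theorem mem_boundedClouds_iff {R : ℝ} (hR : 0 ≤ R) {X : LimitSpace k} :
    X ∈ boundedClouds k R ↔ ∀ᵐ t, ‖X t‖ ≤ R := by
  change eLpNorm X ∞ volume ≤ ENNReal.ofReal R ↔ _
  rw [eLpNorm_exponent_top]
  refine ⟨fun h => ?_, eLpNormEssSup_le_of_ae_bound⟩
  filter_upwards [ae_le_eLpNormEssSup (f := X) (μ := volume)] with t ht
  have := ht.trans h
  rwa [← ofReal_norm, ENNReal.ofReal_le_ofReal_iff hR] at this

/-- A sequence that converges in `L²` has a subsequence converging almost everywhere, which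
preserves pointwise bounds. -/
theorem isClosed_boundedClouds {R : ℝ} (hR : 0 ≤ R) : IsClosed (boundedClouds k R) := by
  refine IsSeqClosed.isClosed fun X Y hX hXY => ?_
  obtain ⟨ns, -, hns⟩ := (tendstoInMeasure_of_tendsto_Lp hXY).exists_seq_tendsto_ae
  rw [mem_boundedClouds_iff hR]
  filter_upwards [hns, ae_all_iff.2 fun n => (mem_boundedClouds_iff hR).1 (hX n)] with t ht hb
  exact le_of_tendsto ht.norm (Eventually.of_forall fun n => hb _)

theorem apply_mem_boundedClouds {R : ℝ} (hR : 0 ≤ R) {g : LimitSpace k ≃ₗᵢ[ℝ] LimitSpace k}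
    (hg : g ∈ fullGroup k) {X : LimitSpace k} (hX : X ∈ boundedClouds k R) :
    g X ∈ boundedClouds k R := by
  obtain ⟨g, rfl⟩ := hg
  rw [mem_boundedClouds_iff hR] at hX ⊢
  filter_upwards [coeFn_actFun k g X, g.1.2.2.quasiMeasurePreserving.ae hX] with t h1 h2
  rw [act_apply, h1, LinearIsometryEquiv.norm_map]
  exact h2

/-! ### Step clouds and the action of `S_n` -/

theorem measurable_floor_mul (n : ℕ) : Measurable fun t : unitInterval => ⌊(n : ℝ) * t⌋₊ :=
  Nat.measurable_floor.comp ((measurable_const_mul _).comp measurable_subtype_coe)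

theorem memLp_step (n : ℕ) (v : ℕ → EuclideanSpace ℝ (Fin k)) :
    MemLp (fun t : unitInterval => v ⌊(n : ℝ) * t⌋₊) 2 volume := by
  have hm : Measurable fun t : unitInterval => v ⌊(n : ℝ) * t⌋₊ :=
    (measurable_from_top (f := v)).comp (measurable_floor_mul n)
  refine MemLp.of_bound hm.aestronglyMeasurable (∑ i ∈ Finset.range (n + 1), ‖v i‖)
    (Eventually.of_forall fun t => ?_)
  refine Finset.single_le_sum (f := fun i => ‖v i‖) (fun i _ => norm_nonneg _) ?_
  rw [Finset.mem_range, Nat.lt_succ_iff]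
  exact Nat.floor_le_of_le (mul_le_of_le_one_right (Nat.cast_nonneg n) t.2.2)

/-- The cloud with the value `v i` on the interval `[i / n, (i + 1) / n)`. -/
def stepCloud (n : ℕ) (v : ℕ → EuclideanSpace ℝ (Fin k)) : LimitSpace k :=
  (memLp_step n v).toLp _

theorem coeFn_stepCloud (n : ℕ) (v : ℕ → EuclideanSpace ℝ (Fin k)) :
    stepCloud n v =ᵐ[volume] fun t => v ⌊(n : ℝ) * t⌋₊ :=
  MemLp.coeFn_toLp _

/-- The group acts through `φ⁻¹`, so `σ⁻¹` reorders the values by `σ`. -/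
theorem act_intervalPerm_stepCloud (n : ℕ) (σ : Equiv.Perm (Fin n))
    (v : ℕ → EuclideanSpace ℝ (Fin k)) :
    act k (intervalPerm n σ⁻¹, 1) (stepCloud n v) = stepCloud n (v ∘ extendPerm n σ) := by
  refine Lp.ext ?_
  filter_upwards [coeFn_actFun k (intervalPerm n σ⁻¹, 1) (stepCloud n v),
    (intervalPerm n σ⁻¹).2.2.quasiMeasurePreserving.ae (coeFn_stepCloud n v),
    coeFn_stepCloud n (v ∘ extendPerm n σ)] with t h1 h2 h3
  rw [act_apply, h1, h3]
  refine h2.trans (congrArg v ?_)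
  change ⌊(n : ℝ) * intervalShift n σ⁻¹⁻¹ t⌋₊ = _
  rw [inv_inv, floor_intervalShift σ t.2.1]

/-! ### Sorted clouds -/

theorem ae_lt_one : ∀ᵐ t : unitInterval, (t : ℝ) < 1 := by
  filter_upwards [compl_mem_ae_iff.2 (measure_singleton (μ := volume) (1 : unitInterval))] with t ht
  exact lt_of_le_of_ne t.2.2 fun h => ht (Subtype.ext h)

/-- The cloud with the value `F i` on the interval `[b i, b (i + 1))`, and zero elsewhere, when `b`
is monotone. As a combination of indicators of initial intervals it depends continuously on `b`. -/
def sortedCloud {m : ℕ} (F : Fin m → EuclideanSpace ℝ (Fin k)) (b : ℕ → unitInterval) :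
    LimitSpace k :=
  ∑ i : Fin m, (indicatorConstLp 2 (measurableSet_Iio (a := b (i + 1))) (measure_ne_top _ _) (F i)
    - indicatorConstLp 2 (measurableSet_Iio (a := b i)) (measure_ne_top _ _) (F i))

theorem continuous_indicatorConstLp_Iio (c : EuclideanSpace ℝ (Fin k)) :
    Continuous fun x : unitInterval => (indicatorConstLp 2 (measurableSet_Iio (a := x))
      (measure_ne_top volume _) c : LimitSpace k) := by
  refine continuous_indicatorConstLp_set (by norm_num) fun x => ?_
  have hle : ∀ y : unitInterval, volume (symmDiff (Set.Iio y) (Set.Iio x))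
      ≤ ENNReal.ofReal (dist y x) := by
    intro y
    have hsub : symmDiff (Set.Iio y) (Set.Iio x) ⊆ Set.uIcc y x := by
      rintro t (⟨h1, h2⟩ | ⟨h1, h2⟩)
      · exact Set.mem_uIcc.2 (Or.inr ⟨not_lt.1 h2, le_of_lt h1⟩)
      · exact Set.mem_uIcc.2 (Or.inl ⟨not_lt.1 h2, le_of_lt h1⟩)
    refine (measure_mono hsub).trans_eq ?_
    rw [unitInterval.volume_uIcc, edist_dist, dist_comm]
  refine tendsto_of_tendsto_of_tendsto_of_le_of_le tendsto_const_nhds ?_ (fun _ => zero_le) hle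
  have : Tendsto (fun y => ENNReal.ofReal (dist y x)) (𝓝 x) (𝓝 (ENNReal.ofReal (dist x x))) :=
    (ENNReal.continuous_ofReal.comp (continuous_id.dist continuous_const)).tendsto x
  simpa using this

theorem continuous_sortedCloud {m : ℕ} (F : Fin m → EuclideanSpace ℝ (Fin k)) :
    Continuous (sortedCloud F) :=
  continuous_finsetSum _ fun i _ =>
    ((continuous_indicatorConstLp_Iio (F i)).comp (continuous_apply (i + 1 : ℕ))).sub
      ((continuous_indicatorConstLp_Iio (F i)).comp (continuous_apply (i : ℕ)))

theorem coeFn_sortedCloud {m : ℕ} (F : Fin m → EuclideanSpace ℝ (Fin k)) (b : ℕ → unitInterval) :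
    sortedCloud F b =ᵐ[volume] fun t => ∑ i : Fin m,
      ((Set.Iio (b (i + 1))).indicator (fun _ => F i) t
        - (Set.Iio (b i)).indicator (fun _ => F i) t) := by
  refine (Lp.coeFn_finsetSum _ _).trans ?_
  have h : ∀ᵐ t, ∀ i : Fin m,
      (indicatorConstLp 2 (measurableSet_Iio (a := b (i + 1))) (measure_ne_top _ _) (F i)
        - indicatorConstLp 2 (measurableSet_Iio (a := b i)) (measure_ne_top _ _) (F i) :
          LimitSpace k) t
      = (Set.Iio (b (i + 1))).indicator (fun _ => F i) t
        - (Set.Iio (b i)).indicator (fun _ => F i) t := by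
    refine ae_all_iff.2 fun i => ?_
    filter_upwards [Lp.coeFn_sub
      (indicatorConstLp 2 (measurableSet_Iio (a := b (i + 1))) (measure_ne_top volume _) (F i))
      (indicatorConstLp 2 (measurableSet_Iio (a := b i)) (measure_ne_top volume _) (F i)),
      indicatorConstLp_coeFn (p := 2) (hs := measurableSet_Iio (a := b (i + 1)))
        (hμs := measure_ne_top volume _) (c := F i),
      indicatorConstLp_coeFn (p := 2) (hs := measurableSet_Iio (a := b i))
        (hμs := measure_ne_top volume _) (c := F i)] with t h1 h2 h3
    rw [h1, Pi.sub_apply, h2, h3]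
  filter_upwards [h] with t ht
  rw [Finset.sum_apply]
  exact Finset.sum_congr rfl fun i _ => ht i

/-- A step cloud with nondecreasing indices of values is a sorted cloud; the breakpoint `b i` is the
proportion of indices below `i`. -/
theorem exists_stepCloud_eq_sortedCloud {m n : ℕ} (hn : 0 < n)
    (F : Fin m → EuclideanSpace ℝ (Fin k)) (a : ℕ → Fin m)
    (ha : Monotone fun j : Fin n => (a j : ℕ)) :
    ∃ b, stepCloud n (fun j => F (a j)) = sortedCloud F b := by
  have hn' : (0 : ℝ) < n := by exact_mod_cast hn
  let c : ℕ → ℕ := fun i => (Finset.univ.filter fun j : Fin n => (a j : ℕ) < i).card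
  have hc : ∀ i, (c i : ℝ) / n ∈ unitInterval := fun i =>
    ⟨by positivity, div_le_one_of_le₀
      (by exact_mod_cast (Finset.card_le_univ _).trans_eq (Fintype.card_fin n)) hn'.le⟩
  refine ⟨fun i => ⟨c i / n, hc i⟩, Lp.ext ?_⟩
  filter_upwards [coeFn_stepCloud n (fun j => F (a j)), coeFn_sortedCloud F _, ae_lt_one]
    with t h1 h2 h3
  rw [h1, h2]
  set j := ⌊(n : ℝ) * t⌋₊
  have hjn : j < n := (Nat.floor_lt (mul_nonneg hn'.le t.2.1)).2 (by nlinarith)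
  -- As `a` is monotone, the indices with `a j < i` form an initial segment, of length `c i`.
  have hmem : ∀ i, t ∈ Set.Iio (⟨c i / n, hc i⟩ : unitInterval) ↔ (a j : ℕ) < i := by
    intro i
    rw [← Tuple.lt_card_lt_iff_apply_lt_of_monotone (j := ⟨j, hjn⟩) ha, Set.mem_Iio,
      ← Subtype.coe_lt_coe, lt_div_iff₀' hn', ← Nat.floor_lt (mul_nonneg hn'.le t.2.1)]
  simp only [Set.indicator_apply, hmem]
  -- Only the term of the value taken at `t` is nonzero.
  rw [Finset.sum_eq_single (a j)]
  · simp
  · intro i _ hi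
    have hi' : (a j : ℕ) ≠ i := fun h => hi (Fin.ext h.symm)
    have : (a j : ℕ) < (i : ℕ) + 1 ↔ (a j : ℕ) < i := by omega
    simp [this]
  · simp

/-- Every step cloud with values in a finite family is moved to a sorted cloud by the permutation
that sorts the indices of its values. -/
theorem exists_limitGroup_apply_stepCloud {m n : ℕ} (hn : 0 < n)
    (F : Fin m → EuclideanSpace ℝ (Fin k)) (a : ℕ → Fin m) :
    ∃ g ∈ limitGroup k, ∃ b, g (stepCloud n fun j => F (a j)) = sortedCloud F b := by
  let σ := Tuple.sort fun j : Fin n => (a j : ℕ)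
  have hmono : Monotone fun j : Fin n => (a (extendPerm n σ j) : ℕ) := by
    have h : (fun j : Fin n => (a (extendPerm n σ j) : ℕ)) = (fun j : Fin n => (a j : ℕ)) ∘ σ :=
      funext fun j => by rw [extendPerm_of_lt σ j.2]; rfl
    rw [h]
    exact Tuple.monotone_sort _
  refine ⟨act k (intervalPerm n σ⁻¹, 1), ⟨_, ⟨⟨n, hn, σ⁻¹, rfl⟩, trivial⟩, rfl⟩, ?_⟩
  obtain ⟨b, hb⟩ := exists_stepCloud_eq_sortedCloud hn F (fun j => a (extendPerm n σ j)) hmono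
  exact ⟨b, (act_intervalPerm_stepCloud n σ _).trans hb⟩

/-! ### Approximation of bounded clouds by sorted clouds -/

/-- Every cloud bounded by `R` is close to a step cloud with values in a given net of the ball of
radius `R`: a continuous approximation is sampled at the points `i / n`, and the samples are rounded
to nearest points of the net. -/
theorem exists_norm_sub_stepCloud_lt {R ε : ℝ} (hR : 0 < R) (hε : 0 < ε) {m : ℕ}
    (F : Fin m → EuclideanSpace ℝ (Fin k))
    (hF : ∀ x : EuclideanSpace ℝ (Fin k), ‖x‖ ≤ R → ∃ i, ‖F i - x‖ < ε) {X : LimitSpace k}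
    (hX : X ∈ boundedClouds k R) :
    ∃ n, 0 < n ∧ ∃ a : ℕ → Fin m, ‖X - stepCloud n (fun j => F (a j))‖ ≤ 5 * ε := by
  have : Nonempty (Fin m) := ⟨(hF 0 (by simpa using hR.le)).choose⟩
  obtain ⟨f, hXf, -⟩ := (Lp.memLp X).exists_boundedContinuous_eLpNorm_sub_le (by norm_num)
    (ε := ENNReal.ofReal ε) (by simpa using hε)
  obtain ⟨δ, hδ, hfδ⟩ := Metric.uniformContinuous_iff.1
    (CompactSpace.uniformContinuous_of_continuous f.continuous) ε hε
  obtain ⟨n, hn⟩ := exists_nat_one_div_lt hδ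
  choose r hr using fun x => Finite.exists_min fun i => ‖F i - x‖
  let s : ℕ → unitInterval := fun j => Set.projIcc 0 1 zero_le_one ((j : ℝ) / (n + 1 : ℕ))
  refine ⟨n + 1, n.succ_pos, fun j => r (f (s j)), ?_⟩
  have hs : ∀ t : unitInterval, ‖f t - f (s ⌊((n + 1 : ℕ) : ℝ) * t⌋₊)‖ ≤ ε := by
    intro t
    rw [← dist_eq_norm]
    refine (hfδ ?_).le
    set N := n + 1 with hN
    have hN' : (0 : ℝ) < N := by positivity
    have h1 := Nat.floor_le (mul_nonneg hN'.le t.2.1)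
    have h2 := Nat.lt_floor_add_one ((N : ℝ) * t)
    set j := ⌊(N : ℝ) * t⌋₊
    have h3 : (j : ℝ) / N ≤ t := by rwa [div_le_iff₀' hN']
    have h4 : (t : ℝ) - j / N < δ := by
      refine lt_of_le_of_lt ?_ hn
      have : (t : ℝ) - j / N = (N * t - j) / N := by field_simp
      rw [this, hN, Nat.cast_add, Nat.cast_one]
      gcongr
      rw [hN, Nat.cast_add, Nat.cast_one] at h2
      linarith
    have h5 : (s j : ℝ) = j / N :=
      congrArg Subtype.val (Set.projIcc_of_mem zero_le_one ⟨by positivity, h3.trans t.2.2⟩)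
    rw [Subtype.dist_eq, h5, Real.dist_eq, abs_of_nonneg (sub_nonneg.2 h3)]
    exact h4
  -- Rounding a sample `y` to the net moves it at most `‖y - X t‖ + ε`, as `X t` lies in the ball; so
  -- the samples themselves need not lie in the ball.
  have hpt : ∀ᵐ t : unitInterval, ‖(X - stepCloud (n + 1) (fun j => F (r (f (s j))))) t‖
      ≤ 2 * ‖(X - f : unitInterval → EuclideanSpace ℝ (Fin k)) t‖ + 3 * ε := by
    filter_upwards [(mem_boundedClouds_iff hR.le).1 hX, Lp.coeFn_sub X (stepCloud (n + 1) _),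
      coeFn_stepCloud (n + 1) (fun j => F (r (f (s j))))] with t h1 h2 h3
    rw [h2, Pi.sub_apply, h3, Pi.sub_apply]
    set y := f (s ⌊((n + 1 : ℕ) : ℝ) * t⌋₊)
    obtain ⟨i, hi⟩ := hF _ h1
    have h4 := hr y i
    have h5 := norm_sub_le_norm_sub_add_norm_sub (F i) (X t) y
    have h6 := norm_sub_le_norm_sub_add_norm_sub (X t) (f t) y
    have h7 := norm_sub_le_norm_sub_add_norm_sub (X t) y (F (r y))
    have h8 := hs t
    rw [norm_sub_rev y] at h7
    linarith
  rw [Lp.norm_def]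
  refine ENNReal.toReal_le_of_le_ofReal (by positivity) ((eLpNorm_mono_ae_real hpt).trans ?_)
  have hm : AEStronglyMeasurable (X - f : unitInterval → EuclideanSpace ℝ (Fin k)) volume :=
    (Lp.aestronglyMeasurable X).sub f.continuous.aestronglyMeasurable
  refine (eLpNorm_add_le (hm.norm.const_mul 2) aestronglyMeasurable_const (by norm_num)).trans ?_
  have h1 : eLpNorm (fun t => 2 * ‖(X - f : unitInterval → EuclideanSpace ℝ (Fin k)) t‖) 2 volume
      ≤ ENNReal.ofReal (2 * ε) := by
    refine (eLpNorm_const_smul (2 : ℝ)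
      (fun t => ‖(X - f : unitInterval → EuclideanSpace ℝ (Fin k)) t‖) 2 volume).trans_le ?_
    rw [eLpNorm_norm, Real.enorm_eq_ofReal two_pos.le, ENNReal.ofReal_mul two_pos.le]
    gcongr
  have h2 : eLpNorm (fun _ : unitInterval => 3 * ε) 2 volume = ENNReal.ofReal (3 * ε) := by
    rw [eLpNorm_const _ (by norm_num) (NeZero.ne _), measure_univ, ENNReal.one_rpow, mul_one,
      Real.enorm_eq_ofReal (by positivity)]
  refine (add_le_add h1 h2.le).trans_eq ?_
  rw [← ENNReal.ofReal_add (by positivity) (by positivity)]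
  congr 1
  ring

/-- Up to a small error, every bounded cloud can be moved by `G_∞` to a sorted cloud with values
in a fixed finite set; these sorted clouds form a compact set. -/
theorem exists_totallyBounded_symDist_lt {R : ℝ} (hR : 0 < R) {ε : ℝ} (hε : 0 < ε) :
    ∃ B : Set (LimitSpace k), TotallyBounded B ∧
      ∀ X ∈ boundedClouds k R, ∃ Y ∈ B, symDist (limitGroup k) X Y < ε := by
  obtain ⟨t, ht, hcover⟩ := Metric.totallyBounded_iff.1
    (isCompact_closedBall (0 : EuclideanSpace ℝ (Fin k)) R).totallyBounded (ε / 6) (by positivity)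
  obtain ⟨m, F, -, rfl⟩ := ht.fin_param
  refine ⟨Set.range (sortedCloud F),
    (isCompact_range (continuous_sortedCloud F)).totallyBounded, fun X hX => ?_⟩
  have hF : ∀ x : EuclideanSpace ℝ (Fin k), ‖x‖ ≤ R → ∃ i, ‖F i - x‖ < ε / 6 := by
    intro x hx
    obtain ⟨_, ⟨i, rfl⟩, hi⟩ := Set.mem_iUnion₂.1 (hcover (mem_closedBall_zero_iff.2 hx))
    exact ⟨i, by rwa [Metric.mem_ball, dist_comm, dist_eq_norm] at hi⟩
  obtain ⟨n, hn, a, ha⟩ := exists_norm_sub_stepCloud_lt hR (by positivity) F hF hX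
  obtain ⟨g, hg, b, hb⟩ := exists_limitGroup_apply_stepCloud hn F a
  refine ⟨_, ⟨b, rfl⟩, (symDist_le _ _ _ hg).trans_lt ?_⟩
  rw [← hb, ← map_sub, LinearIsometryEquiv.norm_map]
  linarith

end Clouds

end PointCloud

end

theorem mainTheorem9 (k : ℕ) (R : ℝ) (hR : 0 < R) :
    IsCompact (PointCloud.orbitClosuresOf (PointCloud.limitGroup k)
      (PointCloud.boundedClouds k R)) ∧
    IsCompact (PointCloud.orbitClosuresOf (PointCloud.fullGroup k)
      (PointCloud.boundedClouds k R)) := by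
  open PointCloud in
  have hle := limitGroup_le_fullGroup k
  refine ⟨isCompact_orbitClosuresOf _ (isClosed_boundedClouds hR.le)
    (fun g hg X hX => apply_mem_boundedClouds hR.le (hle hg) hX)
    fun ε hε => exists_totallyBounded_symDist_lt hR hε,
    isCompact_orbitClosuresOf _ (isClosed_boundedClouds hR.le)
    (fun g hg X hX => apply_mem_boundedClouds hR.le hg hX) fun ε hε => ?_⟩
  obtain ⟨B, hB, h⟩ := exists_totallyBounded_symDist_lt (k := k) hR hε
  refine ⟨B, hB, fun X hX => ?_⟩
  obtain ⟨Y, hY, hXY⟩ := h X hX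
  exact ⟨Y, hY, (symDist_anti hle X Y).trans_lt hXY⟩
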